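/- Let $\mathbb{K}$ be a perfect field of characteristic $p>0$, let $\mathbf{w}=(w_1,\dots,w_n)$ and $\mathbf{a}=(a_1,\dots,a_n)$ be $n$-tuples of positive integers, and put $|\mathbf{a}|_{\mathbf{w}}=\sum_{i=1}^n w_ia_i$, $\mathfrak{m}=(x_1,\dots,x_n)$ and $\mathfrak{m}(\mathbf{a})=(x_1^{a_1},\dots,x_n^{a_n})$ in $\mathbb{K}[x_1,\dots,x_n]$. Let $f\in\mathfrak{m}$ be a nonzero polynomial that is weighted homogeneous of type $(\mathbf{w},d)$, i.e. every monomial $x^{\mathbf{u}}$ occurring in $f$ has $|\mathbf{u}|_{\mathbf{w}}=d$. Suppose that the Jacobian ideal $\left(\frac{\partial f}{\partial x_1},\dots,\frac{\partial f}{\partial x_n}\right)$ is $\mathfrak{m}$-primary and that $|\mathbf{a}|_{\mathbf{w}}\le d$. For $e\in\mathbb{N}$ let $\mathfrak{m}(\mathbf{a})^{[p^e]}$ be the ideal generated by the $p^e$-th powers of the elements of $\mathfrak{m}(\mathbf{a})$, and let $\nu(p^e)=\max\{N\in\mathbb{N}: f^N\notin\mathfrak{m}(\mathbf{a})^{[p^e]}\}$.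 Then these maxima exist, the $F$-threshold $c^{\mathfrak{m}(\mathbf{a})}(f)=\lim_{e\to\infty}\nu(p^e)/p^e$ exists, and either $$c^{\mathfrak{m}(\mathbf{a})}(f)=\frac{|\mathbf{a}|_{\mathbf{w}}}{d}\qquad\text{or}\qquad c^{\mathfrak{m}(\mathbf{a})}(f)=\left[\frac{|\mathbf{a}|_{\mathbf{w}}}{d}\right]_L-\frac{E}{p^L}$$ for some integer $L\ge 1$ and some $E\in\{0,\dots,n-1\}$. Here, for $\lambda\in(0,1]$ with its unique non-terminating base $p$ expansion $\lambda=\sum_{i\ge1}\lambda^{(i)}/p^i$ (digits $\lambda^{(i)}\in\{0,\dots,p-1\}$, not eventually zero), $[\lambda]_L=\sum_{i=1}^L\lambda^{(i)}/p^i$. -/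

import Mathlib

/-- The Frobenius power `I^[p^e]`: the ideal generated by the `p^e`-th powers of the
elements of `I`. -/
def frobeniusPower {R : Type*} [CommRing R] (p : ℕ) (I : Ideal R) (e : ℕ) : Ideal R :=
  Ideal.span {x : R | ∃ y ∈ I, x = y ^ p ^ e}

/-- `ν` is the largest natural number `N` such that `I ^ N` is not contained in the
Frobenius power `J^[p^e]`. -/
def IsNuInvariant {R : Type*} [CommRing R] (p : ℕ) (I J : Ideal R) (e ν : ℕ) : Prop :=
  IsGreatest {N : ℕ | ¬ I ^ N ≤ frobeniusPower p J e} ν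

/-- `c` is the `F`-threshold of `I` with respect to `J`: all the maxima
`ν_e = max {N | I ^ N ⊄ J^[p^e]}` exist, and `ν_e / p^e` tends to `c`. -/
def IsFThreshold {R : Type*} [CommRing R] (p : ℕ) (I J : Ideal R) (c : ℝ) : Prop :=
  ∃ ν : ℕ → ℕ, (∀ e, IsNuInvariant p I J e (ν e)) ∧
    Filter.Tendsto (fun e : ℕ => (ν e : ℝ) / (p : ℝ) ^ e) Filter.atTop (nhds c)

/-- The `F`-threshold is unique. -/
theorem IsFThreshold.unique {R : Type*} [CommRing R] {p : ℕ} {I J : Ideal R} {c c' : ℝ}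
    (h : IsFThreshold p I J c) (h' : IsFThreshold p I J c') : c = c' := by
  obtain ⟨ν, hν, hc⟩ := h
  obtain ⟨ν', hν', hc'⟩ := h'
  have : ν = ν' := funext fun e => (hν e).unique (hν' e)
  subst this
  exact tendsto_nhds_unique hc hc'

/-- The weighted size `|a|_w = ∑ i, w i * a i` of an exponent vector. -/
def weightedSize {n : ℕ} (w a : Fin n → ℕ) : ℕ := ∑ i, w i * a i

/-- The ideal `(x_1, ..., x_n)` of `K[x_1, ..., x_n]`. -/
noncomputable def originIdeal (K : Type*) [Field K] (n : ℕ) : Ideal (MvPolynomial (Fin n) K) :=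
  Ideal.span (Set.range fun i => MvPolynomial.X i)

/-- The ideal `𝔪(a) = (x_1 ^ a_1, ..., x_n ^ a_n)` of `K[x_1, ..., x_n]`. -/
noncomputable def powerIdeal (K : Type*) [Field K] {n : ℕ} (a : Fin n → ℕ) :
    Ideal (MvPolynomial (Fin n) K) :=
  Ideal.span (Set.range fun i => MvPolynomial.X i ^ a i)

/-- The Jacobian ideal `(∂f/∂x_1, ..., ∂f/∂x_n)`. -/
noncomputable def jacobianIdeal {K : Type*} [Field K] {n : ℕ} (f : MvPolynomial (Fin n) K) :
    Ideal (MvPolynomial (Fin n) K) :=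
  Ideal.span (Set.range fun i => MvPolynomial.pderiv i f)

/-- `f` is weighted homogeneous of type `(w, d)`: it is nonzero, and every monomial in its
support has weighted degree `d`. -/
def IsWHOfType {K : Type*} [Field K] {n : ℕ} (w : Fin n → ℕ) (d : ℕ)
    (f : MvPolynomial (Fin n) K) : Prop :=
  f ≠ 0 ∧ f.IsWeightedHomogeneous w d

/-- `δ` is the non-terminating base `p` expansion of `x`: one has
`x = ∑ i, δ i / p ^ (i + 1)`, and the digits are not eventually zero. (Digits are indexed
from `0`: the digit of `1 / p ^ e` is `δ (e - 1)`.) -/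
def IsNonterminatingExpansion (p : ℕ) (x : ℝ) (δ : ℕ → Fin p) : Prop :=
  Real.ofDigits δ = x ∧ ∀ N : ℕ, ∃ i ≥ N, (δ i : ℕ) ≠ 0

/-- The sum of the first `e` terms of the base `p` expansion with digits `δ`. -/
noncomputable def truncation {p : ℕ} (δ : ℕ → Fin p) (e : ℕ) : ℝ :=
  ∑ i ∈ Finset.range e, ((δ i : ℕ) : ℝ) / (p : ℝ) ^ (i + 1)

/-- A real number has at most one non-terminating base `p` expansion. -/
theorem IsNonterminatingExpansion.unique {p : ℕ} {x : ℝ} {δ ε : ℕ → Fin p}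
    (hδ : IsNonterminatingExpansion p x δ) (hε : IsNonterminatingExpansion p x ε) : δ = ε := by
  have hp : 0 < p := (δ 0).pos
  have hp' : (0 : ℝ) < p := by exact_mod_cast hp
  have key : ∀ (γ : ℕ → Fin p), IsNonterminatingExpansion p x γ → ∀ e : ℕ, ∃ m : ℕ,
      (p : ℝ) ^ e * truncation γ e = m ∧ (m : ℝ) < p ^ e * x ∧ p ^ e * x ≤ m + 1 := by
    intro γ hγ e
    have hm : ∀ e : ℕ, ∃ m : ℕ, (p : ℝ) ^ e * truncation γ e = m := by
      intro e
      induction e with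
      | zero => exact ⟨0, by simp [truncation]⟩
      | succ e ih =>
        obtain ⟨m, hm⟩ := ih
        refine ⟨p * m + γ e, ?_⟩
        unfold truncation at hm ⊢
        rw [Finset.sum_range_succ]
        push_cast
        rw [← hm]
        field_simp
        try ring
    obtain ⟨m, hm⟩ := hm e
    have hs := Real.ofDigits_eq_sum_add_ofDigits γ e
    have ht : ∑ i ∈ Finset.range e, Real.ofDigitsTerm γ i = truncation γ e :=
      Finset.sum_congr rfl fun i _ => by simp [Real.ofDigitsTerm, div_eq_mul_inv]
    rw [hγ.1, ht] at hs
    have hx : (p : ℝ) ^ e * x = m + Real.ofDigits (fun i => γ (i + e)) := by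
      rw [hs, mul_add, hm]
      field_simp
    have h1 := Real.ofDigits_le_one (fun i => γ (i + e))
    have h0 : 0 < Real.ofDigits (fun i => γ (i + e)) := by
      obtain ⟨i, hi, hne⟩ := hγ.2 e
      unfold Real.ofDigits
      refine Real.summable_ofDigitsTerm.tsum_pos (fun _ => Real.ofDigitsTerm_nonneg) (i - e) ?_
      have : i - e + e = i := by omega
      have h2 : (0 : ℝ) < ((γ i : ℕ) : ℝ) := by
        exact_mod_cast Nat.pos_of_ne_zero hne
      simp only [Real.ofDigitsTerm, this]
      positivity
    exact ⟨m, hm, by linarith, by linarith⟩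
  have trunc_eq : ∀ e, truncation δ e = truncation ε e := by
    intro e
    obtain ⟨m, hm, h1, h2⟩ := key δ hδ e
    obtain ⟨k, hk, h3, h4⟩ := key ε hε e
    have h5 : (m : ℝ) < ((k + 1 : ℕ) : ℝ) := by push_cast; linarith
    have h6 : (k : ℝ) < ((m + 1 : ℕ) : ℝ) := by push_cast; linarith
    have h7 : m = k := by
      have := Nat.cast_lt.mp h5
      have := Nat.cast_lt.mp h6
      omega
    have h8 : (p : ℝ) ^ e * truncation δ e = (p : ℝ) ^ e * truncation ε e := by
      rw [hm, hk, h7]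
    exact mul_left_cancel₀ (by positivity) h8
  funext e
  have h := trunc_eq (e + 1)
  have h' := trunc_eq e
  unfold truncation at h h'
  rw [Finset.sum_range_succ, Finset.sum_range_succ, h', add_right_inj,
    div_left_inj' (by positivity)] at h
  exact Fin.ext (by exact_mod_cast h)

/-! Write λ = |a|_w / d and b_e = (x_i ^ (p^e a_i)), the Frobenius power of 𝔪(a). A power f^N
outside b_e has a monomial with every exponent below p^e a_i, so weights give ν_e ≤ p^e λ. Since g^p
∈ b_{e+1} iff g ∈ b_e, one has p ν_e ≤ ν_{e+1} < p (ν_e + 1), and ν_e / p^e increases to a limit c ≤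
λ.

Suppose e > 0 and p ∤ ν_e + 1. The generators of b_e are p-th powers, so differentiating f^(ν_e + 1)
∈ b_e gives f^ν_e · Jac(f) ⊆ b_e. By `mem_span_of_sum_lt_weight`, Jac(f) contains everything in
weights above ∑ (d - w_i) - ∑ w_i. A monomial complementary to one of f^ν_e outside b_e is not in
Jac(f), whence p^e |a|_w ≤ ν_e d + ∑ (d - w_i) < (ν_e + n) d (`le_degree_of_mul_pderiv_mem`).

If c < λ, the gap p^e λ - ν_e is unbounded, so p ∣ ν_e + 1 for all large e. Let L be the last index
where this fails. From L on, ν_e + 1 is multiplied by p at each step, so c = (ν_L + 1) / p^L, and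
the estimate at L bounds E (`exists_limit_of_digit_sequence`). -/

open MvPolynomial Filter Topology

/-! ### Ideals generated by powers of variables -/

section MonomialIdeals

variable {σ R : Type*} [CommRing R]

/-- The ideal generated by the powers `X i ^ k i` of the variables with index in `T`. -/
noncomputable def varPowIdeal (R : Type*) [CommRing R] (T : Set σ) (k : σ → ℕ) :
    Ideal (MvPolynomial σ R) :=
  Ideal.span ((fun i => X i ^ k i) '' T)

theorem mem_varPowIdeal_iff {T : Set σ} {k : σ → ℕ} {q : MvPolynomial σ R} :
    q ∈ varPowIdeal R T k ↔ ∀ u, coeff u q ≠ 0 → ∃ i ∈ T, k i ≤ u i := by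
  have h := @mem_ideal_span_monomial_image σ R _ q ((fun i => Finsupp.single i (k i)) '' T)
  rw [Set.image_image] at h
  have h2 : (fun i => monomial (Finsupp.single i (k i)) (1 : R)) = fun i => X i ^ k i := by
    funext i
    rw [X_pow_eq_monomial]
  rw [h2] at h
  refine h.trans ?_
  simp [Finsupp.single_le_iff]

theorem varPowIdeal_mono {T U : Set σ} (h : T ⊆ U) (k : σ → ℕ) :
    varPowIdeal R T k ≤ varPowIdeal R U k :=
  Ideal.span_mono (Set.image_mono h)

theorem X_pow_mem_varPowIdeal {T : Set σ} {i : σ} (hi : i ∈ T) (k : σ → ℕ) :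
    (X i ^ k i : MvPolynomial σ R) ∈ varPowIdeal R T k :=
  Ideal.subset_span ⟨i, hi, rfl⟩

/-- A power of a variable outside `T` is a nonzerodivisor modulo the ideal: multiplying by it leaves
the exponents in `T` unchanged. -/
theorem mem_varPowIdeal_of_X_pow_mul_mem {T : Set σ} {k : σ → ℕ} {i : σ} (hi : i ∉ T)
    {q : MvPolynomial σ R} (h : X i ^ k i * q ∈ varPowIdeal R T k) : q ∈ varPowIdeal R T k := by
  classical
  rw [mem_varPowIdeal_iff] at h ⊢
  intro u hu
  obtain ⟨j, hj, hle⟩ := h (Finsupp.single i (k i) + u)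
    (by rwa [X_pow_eq_monomial, coeff_monomial_mul, one_mul])
  have hij : i ≠ j := fun h => hi (h ▸ hj)
  exact ⟨j, hj, by simpa [Finsupp.single_apply, hij] using hle⟩

theorem exists_of_mem_varPowIdeal_insert {T : Set σ} {k : σ → ℕ} {i : σ}
    {q : MvPolynomial σ R} (h : q ∈ varPowIdeal R (insert i T) k) :
    ∃ r, q - X i ^ k i * r ∈ varPowIdeal R T k := by
  rw [varPowIdeal, Set.image_insert_eq, Ideal.mem_span_insert] at h
  obtain ⟨a, z, hz, rfl⟩ := h
  exact ⟨a, by rw [mul_comm, add_sub_cancel_left]; exact hz⟩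

end MonomialIdeals

/-! ### The Koszul complex with its homotopies -/

section Koszul

/-- The Koszul complex of `g : Fin m → S` as a free module with a square-zero endomorphism and
contracting homotopies for the multiplications by the `g j`. The basis vectors carry weights for
which the `j`-th homotopy has degree `d j`. -/
theorem exists_koszul {S : Type*} [CommRing S] (m : ℕ) (g : Fin m → S) (d : Fin m → ℕ) :
    ∃ (ι : Type) (_ : Fintype ι) (wt : ι → ℕ) (t₀ : ι) (D : (ι → S) →ₗ[S] (ι → S))
      (s : Fin m → (ι → S) →ₗ[S] (ι → S)),
      (∀ z, D (D z) = 0) ∧ (∀ j z, D (s j z) + s j (D z) = g j • z) ∧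
      (∀ t, wt t ≤ ∑ j, d j) ∧
      (∀ j t, (∀ z, s j z t = 0) ∨
        ∃ t', wt t = wt t' + d j ∧ ((∀ z, s j z t = z t') ∨ ∀ z, s j z t = -z t')) ∧
      (∀ z t, D z t ∈ Ideal.span (Set.range g)) ∧
      (∀ z, (∀ t, t ≠ t₀ → z t = 0) → D z = 0) := by
  induction m with
  | zero =>
    refine ⟨Unit, inferInstance, fun _ => 0, (), 0, fun _ => 0, ?_⟩
    simp
  | succ m ih =>
    obtain ⟨ι, hι, wt, t₀, D, s, hDD, hs, hwt, hsh, hD, hDt₀⟩ :=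
      ih (fun j => g j.castSucc) (fun j => d j.castSucc)
    let l : (ι ⊕ ι → S) →ₗ[S] (ι → S) := LinearMap.funLeft S S Sum.inl
    let r : (ι ⊕ ι → S) →ₗ[S] (ι → S) := LinearMap.funLeft S S Sum.inr
    let e : ((ι → S) × (ι → S)) →ₗ[S] (ι ⊕ ι → S) :=
      (LinearEquiv.sumArrowLequivProdArrow ι ι S S).symm.toLinearMap
    have hext : ∀ z z', l z = l z' → r z = r z' → z = z' := by
      intro z z' h1 h2
      funext t
      cases t with
      | inl t => exact congrFun h1 t
      | inr t => exact congrFun h2 t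
    -- Mapping cone of multiplication by the last `g`: `inr` holds the basis vectors containing the
    -- new generator, `inl` the others. The signs make `D'` square to zero.
    let D' : (ι ⊕ ι → S) →ₗ[S] (ι ⊕ ι → S) :=
      e ∘ₗ (D ∘ₗ l + g (Fin.last m) • r).prod (-(D ∘ₗ r))
    have lD : ∀ z, l (D' z) = D (l z) + g (Fin.last m) • r z := fun z => rfl
    have rD : ∀ z, r (D' z) = -D (r z) := fun z => rfl
    let s₁ : Fin m → (ι ⊕ ι → S) →ₗ[S] (ι ⊕ ι → S) :=
      fun j => e ∘ₗ (s j ∘ₗ l).prod (-(s j ∘ₗ r))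
    let s₂ : (ι ⊕ ι → S) →ₗ[S] (ι ⊕ ι → S) := e ∘ₗ (0 : _ →ₗ[S] _).prod l
    have hspan : Ideal.span (Set.range fun j : Fin m => g j.castSucc) ≤
        Ideal.span (Set.range g) :=
      Ideal.span_mono (by rintro _ ⟨j, rfl⟩; exact ⟨_, rfl⟩)
    refine ⟨ι ⊕ ι, inferInstance, Sum.elim wt fun t => wt t + d (Fin.last m), Sum.inl t₀, D',
      Fin.lastCases s₂ s₁, ?_, ?_, ?_, ?_, ?_, ?_⟩
    · intro z
      apply hext
      · rw [lD, lD, rD, map_add, hDD, map_smul, map_zero]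
        simp
      · rw [rD, rD, map_neg, hDD]
        simp
    · intro j z
      induction j using Fin.lastCases with
      | last =>
        simp only [Fin.lastCases_last]
        have l2 : ∀ z, l (s₂ z) = 0 := fun z => rfl
        have r2 : ∀ z, r (s₂ z) = l z := fun z => rfl
        apply hext
        · rw [map_add, lD, l2, l2, r2, map_zero, map_smul]
          simp
        · rw [map_add, rD, r2, r2, lD, map_smul]
          simp
      | cast j =>
        simp only [Fin.lastCases_castSucc]
        have l1 : ∀ z, l (s₁ j z) = s j (l z) := fun z => rfl
        have r1 : ∀ z, r (s₁ j z) = -s j (r z) := fun z => rfl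
        apply hext
        · rw [map_add, lD, l1, l1, r1, lD, map_add, map_smul, map_smul, ← hs]
          simp only [smul_neg]
          abel
        · rw [map_add, rD, r1, r1, rD, map_neg, map_neg, map_smul, ← hs]
          simp
    · intro t
      rw [Fin.sum_univ_castSucc]
      cases t with
      | inl t => exact (hwt t).trans (Nat.le_add_right _ _)
      | inr t => exact Nat.add_le_add_right (hwt t) _
    · intro j t
      induction j using Fin.lastCases with
      | last =>
        simp only [Fin.lastCases_last]
        cases t with
        | inl t => exact Or.inl fun z => rfl
        | inr t => exact Or.inr ⟨Sum.inl t, rfl, Or.inl fun z => rfl⟩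
      | cast j =>
        simp only [Fin.lastCases_castSucc]
        cases t with
        | inl t =>
          rcases hsh j t with h | ⟨t', ht', h | h⟩
          · exact Or.inl fun z => h (l z)
          · exact Or.inr ⟨Sum.inl t', ht', Or.inl fun z => h (l z)⟩
          · exact Or.inr ⟨Sum.inl t', ht', Or.inr fun z => h (l z)⟩
        | inr t =>
          have hr : ∀ z, s₁ j z (Sum.inr t) = -s j (r z) t := fun z => rfl
          have hw' : ∀ t', wt t = wt t' + d j.castSucc →
              wt t + d (Fin.last m) = wt t' + d (Fin.last m) + d j.castSucc := by
            intro t' h; omega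
          rcases hsh j t with h | ⟨t', ht', h | h⟩
          · exact Or.inl fun z => by rw [hr, h, neg_zero]
          · exact Or.inr ⟨Sum.inr t', hw' _ ht', Or.inr fun z => by rw [hr, h]; rfl⟩
          · exact Or.inr ⟨Sum.inr t', hw' _ ht', Or.inl fun z => by rw [hr, h, neg_neg]; rfl⟩
    · intro z t
      cases t with
      | inl t =>
        have : D' z (Sum.inl t) = D (l z) t + g (Fin.last m) * r z t := rfl
        rw [this]
        exact Ideal.add_mem _ (hspan (hD _ _))
          (Ideal.mul_mem_right _ _ (Ideal.subset_span ⟨_, rfl⟩))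
      | inr t =>
        have : D' z (Sum.inr t) = -D (r z) t := rfl
        rw [this]
        exact neg_mem (hspan (hD _ _))
    · intro z hz
      have h1 : D (l z) = 0 := hDt₀ _ fun t ht => hz _ (by simpa using ht)
      have h2 : r z = 0 := funext fun t => hz _ (by simp)
      apply hext
      · rw [lD, h1, h2]
        simp
      · rw [rD, h2]
        simp

end Koszul

/-! ### The socle degree bound -/

section SocleDegree

variable {K : Type*} [CommRing K] {n : ℕ}

theorem exists_weightedHomogeneous_coefficients (w : Fin n → ℕ)
    (g : Fin n → MvPolynomial (Fin n) K) (d : Fin n → ℕ)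
    (hg : ∀ j, (g j).IsWeightedHomogeneous w (d j)) {m : ℕ} (hm : ∀ j, d j ≤ m)
    {h : MvPolynomial (Fin n) K} (hh : h.IsWeightedHomogeneous w m)
    (hmem : h ∈ Ideal.span (Set.range g)) :
    ∃ a : Fin n → MvPolynomial (Fin n) K,
      (∀ j, (a j).IsWeightedHomogeneous w (m - d j)) ∧ ∑ j, a j * g j = h := by
  let _ := weightedGradedAlgebra K w
  obtain ⟨c, hc⟩ := (Ideal.mem_span_range_iff_exists_fun).1 hmem
  refine ⟨fun j => DirectSum.decompose (weightedHomogeneousSubmodule K w) (c j) (m - d j),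
    fun j => (mem_weightedHomogeneousSubmodule K w _ _).1 (SetLike.coe_mem _), ?_⟩
  calc _ = ∑ j, (DirectSum.decompose (weightedHomogeneousSubmodule K w) (c j * g j) m :
          MvPolynomial (Fin n) K) :=
        Finset.sum_congr rfl fun j _ =>
          (DirectSum.coe_decompose_mul_of_right_mem_of_le _ (hg j) (hm j)).symm
    _ = DirectSum.decompose (weightedHomogeneousSubmodule K w) (∑ j, c j * g j) m := by
        rw [DirectSum.decompose_sum, DirectSum.sum_apply]
        simp
    _ = h := by
        rw [hc]
        exact DirectSum.decompose_of_mem_same (weightedHomogeneousSubmodule K w) hh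

/-- If weighted homogeneous polynomials `g j` of degrees `d j`, as many as there are variables,
generate an ideal containing powers of all the variables, then this ideal contains everything in
weights above `∑ d j - ∑ w j`. -/
theorem mem_span_of_sum_lt_weight (w : Fin n → ℕ)
    (g : Fin n → MvPolynomial (Fin n) K) (d : Fin n → ℕ)
    (hg : ∀ j, (g j).IsWeightedHomogeneous w (d j)) (k : Fin n → ℕ)
    (hk : ∀ i, (X i ^ k i : MvPolynomial (Fin n) K) ∈ Ideal.span (Set.range g))
    (hkd : ∀ i j, d j ≤ k i * w i) {h : MvPolynomial (Fin n) K}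
    (hh : ∀ u, coeff u h ≠ 0 → ∑ j, d j < Finsupp.weight w u + ∑ i, w i) :
    h ∈ Ideal.span (Set.range g) := by
  classical
  obtain ⟨ι, _, wt, t₀, D, s, hDD, hs, hwt, hsh, hD, hDt₀⟩ := exists_koszul n g d
  have hXk : ∀ i, (X i ^ k i : MvPolynomial (Fin n) K).IsWeightedHomogeneous w (k i * w i) := by
    intro i
    simpa using (isWeightedHomogeneous_X K w i).pow (k i)
  choose a ha hag using fun i =>
    exists_weightedHomogeneous_coefficients w g d hg (hkd i) (hXk i) (hk i)
  -- Since X_i^k_i = ∑ a_ij g_j, this combination is a homotopy for X_i^k_i; homogeneity of the a_ij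
  -- makes it raise total weight by k_i w_i.
  let τ : Fin n → (ι → MvPolynomial (Fin n) K) →ₗ[MvPolynomial (Fin n) K]
      (ι → MvPolynomial (Fin n) K) := fun i => ∑ j, a i j • s j
  have hτ : ∀ i z, D (τ i z) + τ i (D z) = (X i ^ k i : MvPolynomial (Fin n) K) • z := by
    intro i z
    simp only [τ, LinearMap.sum_apply, LinearMap.smul_apply, map_sum, map_smul]
    rw [← Finset.sum_add_distrib, ← hag i, Finset.sum_smul]
    refine Finset.sum_congr rfl fun j _ => ?_
    rw [← smul_add, hs, smul_smul]
  have hord : ∀ i B z, (∀ t u, coeff u (z t) ≠ 0 → B ≤ Finsupp.weight w u + wt t) →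
      ∀ t u, coeff u (τ i z t) ≠ 0 → B + k i * w i ≤ Finsupp.weight w u + wt t := by
    intro i B z hz t u hu
    have h1 : τ i z t = ∑ j, a i j * s j z t := by
      simp only [τ, LinearMap.sum_apply, LinearMap.smul_apply, Finset.sum_apply, Pi.smul_apply,
        smul_eq_mul]
    rw [h1, coeff_sum] at hu
    obtain ⟨j, -, hj⟩ := Finset.exists_ne_zero_of_sum_ne_zero hu
    rw [coeff_mul] at hj
    obtain ⟨⟨u₁, u₂⟩, hu12, hne⟩ := Finset.exists_ne_zero_of_sum_ne_zero hj
    rw [Finset.HasAntidiagonal.mem_antidiagonal] at hu12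
    simp only at hu12 hne
    have hu1 : Finsupp.weight w u₁ = k i * w i - d j := ha i j (left_ne_zero_of_mul hne)
    have hu2 := right_ne_zero_of_mul hne
    have hle := hkd i j
    rw [← hu12, map_add, hu1]
    rcases hsh j t with h0 | ⟨t', ht', h0⟩
    · rw [h0, coeff_zero] at hu2
      exact absurd rfl hu2
    · have hu3 : coeff u₂ (z t') ≠ 0 := by
        rcases h0 with h0 | h0
        · rwa [h0] at hu2
        · rw [h0, coeff_neg] at hu2
          exact neg_ne_zero.1 hu2
      have := hz _ _ hu3
      omega
  -- Modulo the powers of the variables outside `R`, a cycle of high enough order is a boundary.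
  -- Enlarging `R` by `i` trades the cycle `z` for `τ i z`, a cycle modulo one more power, whose
  -- order is higher by k_i w_i.
  have main : ∀ R : Finset (Fin n), ∀ B z,
      (∀ t u, coeff u (z t) ≠ 0 → B ≤ Finsupp.weight w u + wt t) →
      ∑ j, d j + ∑ i, k i * w i < B + ∑ i ∈ R, k i * w i + ∑ i, w i →
      (∀ t, D z t ∈ varPowIdeal K (↑R : Set (Fin n))ᶜ k) →
      ∃ v, ∀ t, z t - D v t ∈ varPowIdeal K (↑R : Set (Fin n))ᶜ k := by
    intro R
    induction R using Finset.induction_on with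
    | empty =>
      intro B z hz hB _
      refine ⟨0, fun t => ?_⟩
      rw [map_zero, Pi.zero_apply, sub_zero, mem_varPowIdeal_iff]
      intro u hu
      by_contra! hcon
      have h1 := hz t u hu
      have h2 := hwt t
      -- Modulo all the powers, a surviving monomial has exponents at most k_i - 1, so its order is
      -- too small.
      have h3 : Finsupp.weight w u + ∑ i, w i ≤ ∑ i, k i * w i := by
        rw [Finsupp.weight_eq_sum, ← Finset.sum_add_distrib]
        refine Finset.sum_le_sum fun i _ => ?_
        have : u i + 1 ≤ k i := hcon i (by simp)
        calc u i • w i + w i = (u i + 1) * w i := by rw [smul_eq_mul]; ring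
          _ ≤ _ := Nat.mul_le_mul_right _ this
      rw [Finset.sum_empty] at hB
      omega
    | insert i R hi ih =>
      intro B z hz hB hcyc
      have hins : (↑R : Set (Fin n))ᶜ = insert i (↑(insert i R) : Set (Fin n))ᶜ := by
        ext j
        by_cases hji : j = i
        · simp [hji, hi]
        · simp [hji]
      have hi' : i ∉ (↑(insert i R) : Set (Fin n))ᶜ := by simp
      set I := varPowIdeal K (↑(insert i R) : Set (Fin n))ᶜ k
      rw [Finset.sum_insert hi] at hB
      obtain ⟨v, hv⟩ := ih (B + k i * w i) (τ i z) (hord i B z hz) (by omega) (by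
        intro t
        have h1 : D (τ i z) t = X i ^ k i * z t - τ i (D z) t := by
          rw [eq_sub_iff_add_eq]
          exact congrFun (hτ i z) t
        rw [h1, hins]
        exact sub_mem
          (Ideal.mul_mem_right _ _ (X_pow_mem_varPowIdeal (Set.mem_insert _ _) k))
          (varPowIdeal_mono (Set.subset_insert _ _) k (Ideal.map_pi I _ hcyc (τ i) t)))
      choose y hy using fun t => exists_of_mem_varPowIdeal_insert (hins ▸ hv t)
      refine ⟨y, fun t => mem_varPowIdeal_of_X_pow_mul_mem hi' ?_⟩
      -- Apply `D` to τ_i z - D v ≡ X_i^k_i y. As D τ_i z ≡ X_i^k_i z modulo `I`, this gives X_i^k_i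
      -- (z - D y) ∈ I, and X_i^k_i cancels.
      have h2 := Ideal.map_pi I
        (τ i z - D v - (X i ^ k i : MvPolynomial (Fin n) K) • y) hy D t
      rw [map_sub, map_sub, hDD, map_smul, sub_zero] at h2
      have h3 := Ideal.map_pi I _ hcyc (τ i) t
      have h4 := congrFun (hτ i z) t
      simp only [Pi.add_apply, Pi.smul_apply, Pi.sub_apply, smul_eq_mul] at h2 h4
      have h5 : X i ^ k i * (z t - D y t) =
          (D (τ i z) t - X i ^ k i * D y t) + τ i (D z) t := by
        rw [mul_sub, ← h4]; ring
      rw [h5]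
      exact add_mem h2 h3
  -- With `R` everything the ideal is zero, so `h` in position `t₀` is an honest boundary.
  obtain ⟨v, hv⟩ := main Finset.univ (∑ j, d j + 1 - ∑ i, w i) (Pi.single t₀ h)
    (by
      intro t u hu
      by_cases ht : t = t₀
      · subst ht
        rw [Pi.single_eq_same] at hu
        have := hh u hu
        omega
      · simp [ht] at hu)
    (by omega)
    (by
      intro t
      rw [hDt₀ _ fun t ht => Pi.single_eq_of_ne ht _]
      exact zero_mem _)
  have h1 := hv t₀
  rw [Pi.single_eq_same] at h1
  have h2 : h - D v t₀ = 0 := by simpa [varPowIdeal] using h1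
  rw [sub_eq_zero.1 h2]
  exact hD v t₀

end SocleDegree

/-! ### Non-terminating base p expansions -/

section Expansions

theorem truncation_eq_of_digit_recursion {p : ℕ} (hp : 0 < p) {m : ℕ → ℕ} (h0 : m 0 = 0)
    {δ : ℕ → Fin p} (hδ : ∀ e, m (e + 1) = p * m e + δ e) (e : ℕ) :
    truncation δ e = (m e : ℝ) / (p : ℝ) ^ e := by
  have hp' : (0 : ℝ) < p := by exact_mod_cast hp
  induction e with
  | zero => simp [truncation, h0]
  | succ e ih =>
    unfold truncation at ih ⊢
    rw [Finset.sum_range_succ, ih, hδ]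
    push_cast
    field_simp
    ring

/-- Every real number in `(0, 1]` has a non-terminating base `p` expansion; its truncations are
given by the largest integers strictly below `p ^ e * x`. -/
theorem exists_isNonterminatingExpansion {p : ℕ} (hp : 1 < p) {x : ℝ} (hx0 : 0 < x)
    (hx1 : x ≤ 1) :
    ∃ δ : ℕ → Fin p, IsNonterminatingExpansion p x δ ∧
      ∀ e, truncation δ e = ((⌈(p : ℝ) ^ e * x⌉₊ - 1 : ℕ) : ℝ) / (p : ℝ) ^ e := by
  have hp0 : 0 < p := by omega
  have hp' : (1 : ℝ) < p := by exact_mod_cast hp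
  have hp0' : (0 : ℝ) < p := by linarith
  set m : ℕ → ℕ := fun e => ⌈(p : ℝ) ^ e * x⌉₊ - 1 with hm
  have hpos : ∀ e, 0 < ⌈(p : ℝ) ^ e * x⌉₊ := fun e => Nat.ceil_pos.2 (by positivity)
  have hlt : ∀ e, (m e : ℝ) < p ^ e * x := fun e => by
    have : m e < ⌈(p : ℝ) ^ e * x⌉₊ := by have := hpos e; simp only [hm]; omega
    exact Nat.lt_ceil.1 this
  have hle : ∀ e, (p : ℝ) ^ e * x ≤ m e + 1 := fun e => by
    have h1 : m e + 1 = ⌈(p : ℝ) ^ e * x⌉₊ := by have := hpos e; simp only [hm]; omega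
    have h2 := Nat.le_ceil ((p : ℝ) ^ e * x)
    rw [← h1] at h2
    exact_mod_cast h2
  have h0 : m 0 = 0 := by
    have := hlt 0
    rw [pow_zero, one_mul] at this
    have h1 : (m 0 : ℝ) < (1 : ℕ) := by push_cast; linarith
    have := Nat.cast_lt.1 h1
    omega
  have hrec1 : ∀ e, p * m e ≤ m (e + 1) := fun e => by
    have h1 := hlt e
    have h2 := hle (e + 1)
    have h3 : ((p * m e : ℕ) : ℝ) < ((m (e + 1) + 1 : ℕ) : ℝ) := by
      push_cast
      calc (p : ℝ) * m e < p * (p ^ e * x) := by gcongr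
        _ = p ^ (e + 1) * x := by ring
        _ ≤ _ := h2
    have := Nat.cast_lt.1 h3
    omega
  have hrec2 : ∀ e, m (e + 1) < p * m e + p := fun e => by
    have h1 := hle e
    have h2 := hlt (e + 1)
    have h3 : ((m (e + 1) : ℕ) : ℝ) < ((p * m e + p : ℕ) : ℝ) := by
      push_cast
      calc (m (e + 1) : ℝ) < p ^ (e + 1) * x := h2
        _ = p * (p ^ e * x) := by ring
        _ ≤ p * (m e + 1) := by gcongr
        _ = _ := by ring
    exact Nat.cast_lt.1 h3
  let δ : ℕ → Fin p := fun e =>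
    ⟨m (e + 1) - p * m e, by have := hrec1 e; have := hrec2 e; omega⟩
  have hδ : ∀ e, m (e + 1) = p * m e + δ e := fun e => by
    have := hrec1 e
    simp only [δ]
    omega
  have htr := truncation_eq_of_digit_recursion hp0 h0 hδ
  have hbound : ∀ e, truncation δ e < x ∧ x ≤ truncation δ e + ((p : ℝ)⁻¹) ^ e := fun e => by
    have hpe : (0 : ℝ) < p ^ e := by positivity
    rw [htr, inv_pow, ← one_div, ← add_div, div_lt_iff₀ hpe, le_div_iff₀ hpe, mul_comm x]
    exact ⟨hlt e, hle e⟩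
  have hgeom : Tendsto (fun e : ℕ => ((p : ℝ)⁻¹) ^ e) atTop (𝓝 0) :=
    tendsto_pow_atTop_nhds_zero_of_lt_one (by positivity) (inv_lt_one_of_one_lt₀ hp')
  have htend : Tendsto (truncation δ) atTop (𝓝 x) := by
    refine tendsto_of_tendsto_of_tendsto_of_le_of_le (g := fun e => x - ((p : ℝ)⁻¹) ^ e) ?_
      tendsto_const_nhds (fun e => ?_) (fun e => (hbound e).1.le)
    · simpa using hgeom.const_sub x
    · have := (hbound e).2
      simp only
      linarith
  refine ⟨δ, ⟨?_, ?_⟩, htr⟩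
  · have h1 := (Real.summable_ofDigitsTerm (digits := δ)).hasSum.tendsto_sum_nat
    refine tendsto_nhds_unique h1 (htend.congr fun e => ?_)
    exact Finset.sum_congr rfl fun i _ => by simp [Real.ofDigitsTerm, div_eq_mul_inv]
  · intro N
    by_contra! hcon
    have hconst : ∀ k, truncation δ (N + k) = truncation δ N := by
      intro k
      induction k with
      | zero => rfl
      | succ k ih =>
        rw [← ih, ← add_assoc, truncation, Finset.sum_range_succ, hcon (N + k) (by omega)]
        simp [truncation]
    have h1 : Tendsto (fun k => truncation δ (N + k)) atTop (𝓝 x) :=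
      htend.comp (tendsto_atTop_mono (fun k => Nat.le_add_left k N) tendsto_id)
    simp only [hconst] at h1
    exact (hbound N).1.ne (tendsto_nhds_unique tendsto_const_nhds h1)

end Expansions

/-! ### Limits of the digit sequences -/

section Limits

/-- The possible limits of `ν e / p ^ e`, for a sequence that is at most `p ^ e * x` and comes
within `n` of it whenever `p` does not divide `ν e + 1`. -/
theorem exists_limit_of_digit_sequence {p : ℕ} (hp : 1 < p) {ν : ℕ → ℕ}
    (h1 : ∀ e, p * ν e ≤ ν (e + 1)) (h2 : ∀ e, ν (e + 1) + 1 ≤ p * (ν e + 1))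
    {x : ℝ} (hx0 : 0 < x) (hx1 : x ≤ 1) {n : ℕ} (hle : ∀ e, (ν e : ℝ) ≤ p ^ e * x)
    (hclose : ∀ e, 0 < e → ¬ p ∣ ν e + 1 → (p : ℝ) ^ e * x < ν e + n) :
    ∃ c : ℝ, Tendsto (fun e : ℕ => (ν e : ℝ) / (p : ℝ) ^ e) atTop (𝓝 c) ∧
      (c = x ∨ ∃ δ : ℕ → Fin p, IsNonterminatingExpansion p x δ ∧
        ∃ L E : ℕ, 0 < L ∧ E < n ∧ c = truncation δ L - (E : ℝ) / (p : ℝ) ^ L) := by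
  have hp' : (1 : ℝ) < p := by exact_mod_cast hp
  have hp0' : (0 : ℝ) < p := by linarith
  have hmono : Monotone fun e : ℕ => (ν e : ℝ) / (p : ℝ) ^ e := by
    refine monotone_nat_of_le_succ fun e => ?_
    rw [div_le_div_iff₀ (by positivity) (by positivity), pow_succ']
    have : ((p * ν e : ℕ) : ℝ) ≤ ν (e + 1) := by exact_mod_cast h1 e
    push_cast at this
    calc (ν e : ℝ) * (p * p ^ e) = p * ν e * p ^ e := by ring
      _ ≤ ν (e + 1) * p ^ e := by gcongr
  have hub : ∀ e, (ν e : ℝ) / (p : ℝ) ^ e ≤ x := fun e => by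
    rw [div_le_iff₀ (by positivity), mul_comm]
    exact hle e
  have hbdd : BddAbove (Set.range fun e : ℕ => (ν e : ℝ) / (p : ℝ) ^ e) :=
    ⟨x, by rintro _ ⟨e, rfl⟩; exact hub e⟩
  obtain ⟨c, hc⟩ : ∃ c, Tendsto (fun e : ℕ => (ν e : ℝ) / (p : ℝ) ^ e) atTop (𝓝 c) :=
    ⟨_, tendsto_atTop_ciSup hmono hbdd⟩
  refine ⟨c, hc, ?_⟩
  have hcx : c ≤ x := le_of_tendsto' hc hub
  have hνc : ∀ e, (ν e : ℝ) ≤ p ^ e * c := fun e => by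
    have := hmono.ge_of_tendsto hc e
    rwa [div_le_iff₀ (by positivity), mul_comm] at this
  rcases eq_or_lt_of_le hcx with heq | hlt
  · exact Or.inl heq
  right
  -- A failure at e forces p^e x < ν_e + n ≤ p^e c + n, impossible once p^e ≥ n / (x - c).
  have hex : ∃ L, ∀ e, L < e → p ∣ ν e + 1 := by
    obtain ⟨L, hL⟩ := ((tendsto_pow_atTop_atTop_of_one_lt hp').eventually_ge_atTop
      ((n : ℝ) / (x - c))).exists_forall_of_atTop
    refine ⟨L, fun e he => ?_⟩
    by_contra hnd
    have h3 := hclose e (by omega) hnd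
    have h4 := hνc e
    have h5 := hL e he.le
    rw [div_le_iff₀ (by linarith)] at h5
    linarith
  classical
  set L := Nat.find hex
  have hL : ∀ e, L < e → p ∣ ν e + 1 := Nat.find_spec hex
  have hstable : ∀ k, ν (L + k) + 1 = p ^ k * (ν L + 1) := by
    intro k
    induction k with
    | zero => simp
    | succ k ih =>
      obtain ⟨q, hq⟩ := hL (L + (k + 1)) (by omega)
      have h3 := h1 (L + k)
      have h4 := h2 (L + k)
      have h5 : q = ν (L + k) + 1 := by
        rw [← add_assoc] at hq
        apply le_antisymm
        · exact Nat.le_of_mul_le_mul_left (hq ▸ h4) (by omega)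
        · exact Nat.lt_of_mul_lt_mul_left (a := p) (by omega)
      rw [hq, h5, ih]
      ring
  have hpc : (p : ℝ) ^ L * c = ν L + 1 := by
    have h3 : Tendsto (fun k : ℕ => (ν L + 1 : ℝ) / p ^ L - ((p : ℝ)⁻¹) ^ (L + k)) atTop
        (𝓝 ((ν L + 1 : ℝ) / p ^ L - 0)) := by
      refine Tendsto.const_sub _ ?_
      exact (tendsto_pow_atTop_nhds_zero_of_lt_one (by positivity)
        (inv_lt_one_of_one_lt₀ hp')).comp
        (tendsto_atTop_mono (fun k => Nat.le_add_left k L) tendsto_id)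
    have h4 : Tendsto (fun k : ℕ => (ν (L + k) : ℝ) / (p : ℝ) ^ (L + k)) atTop (𝓝 c) :=
      hc.comp (tendsto_atTop_mono (fun k => Nat.le_add_left k L) tendsto_id)
    have h5 : c = (ν L + 1 : ℝ) / p ^ L - 0 := by
      refine tendsto_nhds_unique h4 (h3.congr fun k => ?_)
      have h6 : (ν (L + k) : ℝ) = p ^ k * (ν L + 1) - 1 := by
        rw [eq_sub_iff_add_eq]
        exact_mod_cast hstable k
      rw [h6, inv_pow, pow_add]
      field_simp
    rw [h5, sub_zero]
    field_simp
  -- L = 0 would give c = ν_0 + 1 ≥ 1 ≥ x.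
  have hLpos : 0 < L := by
    rcases Nat.eq_zero_or_pos L with h0 | h0
    · rw [h0, pow_zero, one_mul] at hpc
      have : (0 : ℝ) ≤ ν 0 := Nat.cast_nonneg _
      linarith
    · exact h0
  have hnd : ¬ p ∣ ν L + 1 := by
    intro hd
    refine Nat.find_min hex (m := L - 1) (by omega) fun e he => ?_
    rcases Nat.eq_or_lt_of_le (show L ≤ e by omega) with h | h
    · exact h ▸ hd
    · exact hL e h
  obtain ⟨δ, hδ, htr⟩ := exists_isNonterminatingExpansion hp hx0 hx1
  have hpL : (0 : ℝ) < p ^ L := by positivity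
  have hlt' : ((ν L + 1 : ℕ) : ℝ) < (p : ℝ) ^ L * x := by
    push_cast
    rw [← hpc]
    gcongr
  have h6 : ν L + 1 < ⌈(p : ℝ) ^ L * x⌉₊ := Nat.lt_ceil.2 hlt'
  have h7 : ⌈(p : ℝ) ^ L * x⌉₊ ≤ ν L + n :=
    Nat.ceil_le.2 (by push_cast; exact (hclose L hLpos hnd).le)
  -- E is the numerator of the truncation minus p^L c = ν_L + 1. The subtraction does not truncate
  -- because c < x.
  refine ⟨δ, hδ, L, ⌈(p : ℝ) ^ L * x⌉₊ - 1 - (ν L + 1), hLpos, by omega, ?_⟩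
  rw [htr, ← sub_div, eq_div_iff hpL.ne', mul_comm, hpc, Nat.cast_sub (n := ⌈(p : ℝ) ^ L * x⌉₊ - 1) (by omega)]
  push_cast
  ring

end Limits

/-! ### Frobenius powers and derivations -/

section Frobenius

variable {K : Type*} [Field K] {n : ℕ}

theorem powerIdeal_eq_varPowIdeal (a : Fin n → ℕ) :
    powerIdeal K a = varPowIdeal K Set.univ a := by
  rw [powerIdeal, varPowIdeal, Set.image_univ]

/-- The coefficient of g^(p^e) at p^e u is the p^e-th power of that of g at u, hence nonzero
together with it. -/
theorem pow_mem_varPowIdeal_iff {p : ℕ} [ExpChar K p] (e : ℕ) {T : Set (Fin n)}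
    {k : Fin n → ℕ} {g : MvPolynomial (Fin n) K} :
    g ^ p ^ e ∈ varPowIdeal K T (fun i => p ^ e * k i) ↔ g ∈ varPowIdeal K T k := by
  have hpe : 0 < p ^ e := pow_pos (expChar_pos K p) e
  constructor
  · intro h
    rw [mem_varPowIdeal_iff] at h ⊢
    intro u hu
    obtain ⟨i, hi, hle⟩ := h (p ^ e • u) (by
      rw [← map_iterateFrobenius_expand, coeff_map, coeff_expand_smul _ hpe.ne',
        iterateFrobenius_def]
      exact pow_ne_zero _ hu)
    exact ⟨i, hi, Nat.le_of_mul_le_mul_left (by simpa using hle) hpe⟩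
  · intro h
    have h1 := Ideal.mem_map_of_mem (iterateFrobenius (MvPolynomial (Fin n) K) p e) h
    rw [varPowIdeal, Ideal.map_span, Set.image_image] at h1
    have h2 : (fun i => iterateFrobenius (MvPolynomial (Fin n) K) p e (X i ^ k i)) =
        fun i => X i ^ (p ^ e * k i) := by
      funext i
      rw [iterateFrobenius_def, ← pow_mul, mul_comm]
    rwa [h2] at h1

theorem frobeniusPower_powerIdeal {p : ℕ} [ExpChar K p] (a : Fin n → ℕ) (e : ℕ) :
    frobeniusPower p (powerIdeal K a) e = varPowIdeal K Set.univ (fun i => p ^ e * a i) := by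
  rw [powerIdeal_eq_varPowIdeal]
  apply le_antisymm
  · refine Ideal.span_le.2 ?_
    rintro _ ⟨y, hy, rfl⟩
    exact (pow_mem_varPowIdeal_iff e).2 hy
  · refine Ideal.span_le.2 ?_
    rintro _ ⟨i, hi, rfl⟩
    refine Ideal.subset_span ⟨X i ^ a i, X_pow_mem_varPowIdeal hi a, ?_⟩
    rw [← pow_mul, mul_comm]

/-- An exponent drops below k_i only by differentiating x_i^k_i, and that produces the factor k_i =
0 in `K`. -/
theorem pderiv_mem_varPowIdeal {p : ℕ} [CharP K p] {T : Set (Fin n)} {k : Fin n → ℕ}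
    (hk : ∀ i, p ∣ k i) (i : Fin n) {g : MvPolynomial (Fin n) K} (hg : g ∈ varPowIdeal K T k) :
    pderiv i g ∈ varPowIdeal K T k := by
  rw [mem_varPowIdeal_iff] at hg ⊢
  intro u hu
  rw [coeff_pderiv] at hu
  obtain ⟨j, hj, hle⟩ := hg _ (left_ne_zero_of_mul hu)
  refine ⟨j, hj, ?_⟩
  by_cases hij : i = j
  · subst hij
    have h1 : k i ≤ u i + 1 := by simpa using hle
    rcases Nat.eq_or_lt_of_le h1 with h2 | h2
    · refine absurd ?_ (right_ne_zero_of_mul hu)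
      have := (CharP.cast_eq_zero_iff K p (u i + 1)).2 (h2 ▸ hk i)
      simpa using this
    · omega
  · simpa [Finsupp.single_apply, hij] using hle

theorem exists_coeff_of_notMem_varPowIdeal {k : Fin n → ℕ} {g : MvPolynomial (Fin n) K}
    (hg : g ∉ varPowIdeal K Set.univ k) : ∃ u, coeff u g ≠ 0 ∧ ∀ i, u i < k i := by
  rw [mem_varPowIdeal_iff] at hg
  push Not at hg
  obtain ⟨u, hu, h⟩ := hg
  exact ⟨u, hu, fun i => h i (Set.mem_univ i)⟩

end Frobenius

/-! ### The degree estimate from the Jacobian ideal -/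

section Jacobian

variable {K : Type*} [Field K] {n : ℕ}

theorem isWeightedHomogeneous_pderiv {w : Fin n → ℕ} {d : ℕ} {f : MvPolynomial (Fin n) K}
    (hf : f.IsWeightedHomogeneous w d) (i : Fin n) :
    (pderiv i f).IsWeightedHomogeneous w (d - w i) := by
  rcases le_or_gt (w i) d with h | h
  · exact hf.pderiv (by omega)
  · have h0 : pderiv i f = 0 := by
      ext u
      rw [coeff_pderiv, coeff_zero]
      by_contra hne
      have h1 := hf (left_ne_zero_of_mul hne)
      rw [map_add, Finsupp.weight_single, one_smul] at h1
      omega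
    rw [h0]
    exact isWeightedHomogeneous_zero K w _

/-- If multiplication by all the partial derivatives of `f` moves `g` into `(X i ^ k i)`, then the
degree of a homogeneous `g` outside of this ideal is large. -/
theorem le_degree_of_mul_pderiv_mem {w : Fin n → ℕ} (hw : ∀ i, 0 < w i) {d : ℕ}
    {f : MvPolynomial (Fin n) K} (hf : f.IsWeightedHomogeneous w d)
    (hrad : originIdeal K n ≤ (jacobianIdeal f).radical) {k : Fin n → ℕ}
    {g : MvPolynomial (Fin n) K} {m : ℕ} (hg : g.IsWeightedHomogeneous w m)
    (hgk : g ∉ varPowIdeal K Set.univ k)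
    (hmul : ∀ i, g * pderiv i f ∈ varPowIdeal K Set.univ k) :
    ∑ i, w i * k i ≤ m + ∑ i, (d - w i) := by
  have hX : ∀ i, ∃ r : ℕ, (X i ^ r : MvPolynomial (Fin n) K) ∈ jacobianIdeal f := fun i =>
    Ideal.mem_radical_iff.1 (hrad (Ideal.subset_span ⟨i, rfl⟩))
  choose r hr using hX
  obtain ⟨u, hu, huk⟩ := exists_coeff_of_notMem_varPowIdeal hgk
  -- The exponent complementary to `u`: g · x^v contains x^(k - 1), which lies outside (x_i^k_i).
  let v : Fin n →₀ ℕ := Finsupp.equivFunOnFinite.symm fun i => k i - 1 - u i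
  have hv : ∀ i, v i = k i - 1 - u i := fun i => rfl
  have hnot : (monomial v (1 : K)) ∉ jacobianIdeal f := by
    intro hmem
    have h1 : g * monomial v 1 ∈ varPowIdeal K Set.univ k := by
      have h2 : jacobianIdeal f ≤ Submodule.comap
          (LinearMap.mulLeft (MvPolynomial (Fin n) K) g) (varPowIdeal K Set.univ k) := by
        refine Submodule.span_le.2 ?_
        rintro _ ⟨i, rfl⟩
        exact hmul i
      exact h2 hmem
    rw [mem_varPowIdeal_iff] at h1
    obtain ⟨i, -, hi⟩ := h1 (u + v) (by rwa [coeff_mul_monomial, mul_one])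
    have := huk i
    rw [Finsupp.add_apply, hv] at hi
    omega
  have hle : Finsupp.weight w v + ∑ i, w i ≤ ∑ i, (d - w i) := by
    by_contra! hlt
    refine hnot (mem_span_of_sum_lt_weight w (fun i => pderiv i f) (fun i => d - w i)
      -- Adding `d` to the exponents ensures d - w_j ≤ k_i w_i, as the socle bound requires.
      (isWeightedHomogeneous_pderiv hf) (fun i => r i + d) (fun i => ?_) (fun i j => ?_)
      fun u' hu' => ?_)
    · rw [pow_add]
      exact Ideal.mul_mem_right _ _ (hr i)
    · calc d - w j ≤ (r i + d) * 1 := by omega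
        _ ≤ _ := Nat.mul_le_mul_left _ (hw i)
    · classical
      rw [coeff_monomial] at hu'
      have : v = u' := by
        by_contra hne
        simp [hne] at hu'
      rwa [← this]
  have hsum : Finsupp.weight w u + Finsupp.weight w v + ∑ i, w i = ∑ i, w i * k i := by
    rw [Finsupp.weight_eq_sum, Finsupp.weight_eq_sum, ← Finset.sum_add_distrib,
      ← Finset.sum_add_distrib]
    refine Finset.sum_congr rfl fun i _ => ?_
    have h1 := huk i
    have h2 : u i + v i + 1 = k i := by rw [hv]; omega
    rw [← h2, smul_eq_mul, smul_eq_mul]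
    ring
  have hm : Finsupp.weight w u = m := hg hu
  omega

end Jacobian

/-! ### The F-threshold -/

theorem theorem5p3 {K : Type*} [Field K] [PerfectField K] (p : ℕ) (hp : p.Prime) [CharP K p]
    (n : ℕ) (w : Fin n → ℕ) (hw : ∀ i, 0 < w i) (a : Fin n → ℕ) (ha : ∀ i, 0 < a i)
    (d : ℕ) (f : MvPolynomial (Fin n) K) (hf : IsWHOfType w d f)
    (hfm : f ∈ originIdeal K n)
    (hprim : (jacobianIdeal f).IsPrimary) (hrad : (jacobianIdeal f).radical = originIdeal K n)
    (had : weightedSize w a ≤ d) :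
    ∃ c : ℝ, IsFThreshold p (Ideal.span {f}) (powerIdeal K a) c ∧
      (c = (weightedSize w a : ℝ) / (d : ℝ) ∨
        ∃ δ : ℕ → Fin p,
          IsNonterminatingExpansion p ((weightedSize w a : ℝ) / (d : ℝ)) δ ∧
          ∃ L E : ℕ, 0 < L ∧ E < n ∧ c = truncation δ L - (E : ℝ) / (p : ℝ) ^ L) := by
  have : ExpChar K p := ExpChar.prime hp
  obtain ⟨hf0, hfw⟩ := hf
  have hn : 0 < n := by
    rcases Nat.eq_zero_or_pos n with rfl | h
    · simp [originIdeal, hf0] at hfm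
    · exact h
  have hA : 0 < weightedSize w a :=
    Finset.sum_pos (fun i _ => Nat.mul_pos (hw i) (ha i)) ⟨⟨0, hn⟩, Finset.mem_univ _⟩
  have hd : 0 < d := hA.trans_le had
  have hdR : (0 : ℝ) < d := by exact_mod_cast hd
  set b : ℕ → Ideal (MvPolynomial (Fin n) K) :=
    fun e => varPowIdeal K Set.univ (fun i => p ^ e * a i) with hb
  have hset : ∀ e N, ¬ (Ideal.span {f}) ^ N ≤ frobeniusPower p (powerIdeal K a) e ↔
      f ^ N ∉ b e := by
    intro e N
    rw [Ideal.span_singleton_pow, Ideal.span_singleton_le_iff_mem, frobeniusPower_powerIdeal]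
  have hpow : ∀ N, (f ^ N).IsWeightedHomogeneous w (N * d) := fun N => by
    simpa using hfw.pow N
  have hsize : ∀ e, ∑ i, w i * (p ^ e * a i) = p ^ e * weightedSize w a := fun e => by
    rw [weightedSize, Finset.mul_sum]
    exact Finset.sum_congr rfl fun i _ => by ring
  have hbound : ∀ e N, f ^ N ∉ b e → N * d ≤ p ^ e * weightedSize w a := by
    intro e N hN
    obtain ⟨u, hu, hua⟩ := exists_coeff_of_notMem_varPowIdeal hN
    rw [← hpow N hu, Finsupp.weight_eq_sum, ← hsize]
    refine Finset.sum_le_sum fun i _ => ?_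
    rw [smul_eq_mul, mul_comm]
    exact Nat.mul_le_mul_left _ (hua i).le
  have hgreatest : ∀ e, ∃ ν, IsGreatest {N : ℕ | f ^ N ∉ b e} ν := by
    intro e
    have hne : {N : ℕ | f ^ N ∉ b e}.Nonempty := by
      refine ⟨0, fun h => ?_⟩
      rw [hb, mem_varPowIdeal_iff] at h
      obtain ⟨i, -, hi⟩ := h 0 (by simp)
      have : 0 < p ^ e * a i := Nat.mul_pos (pow_pos hp.pos _) (ha i)
      simp only [Finsupp.zero_apply] at hi
      omega
    have hbdd : BddAbove {N : ℕ | f ^ N ∉ b e} :=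
      ⟨p ^ e * weightedSize w a, fun N hN =>
        (Nat.le_mul_of_pos_right N hd).trans (hbound e N hN)⟩
    exact ⟨_, Nat.sSup_mem hne hbdd, fun N hN => le_csSup hbdd hN⟩
  choose ν hν using hgreatest
  have hfrob : ∀ e N, f ^ (p * N) ∈ b (e + 1) ↔ f ^ N ∈ b e := by
    intro e N
    have h := pow_mem_varPowIdeal_iff (K := K) (p := p) 1 (T := Set.univ)
      (k := fun i => p ^ e * a i) (g := f ^ N)
    have h2 : (fun i => p ^ 1 * (p ^ e * a i)) = fun i => p ^ (e + 1) * a i := by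
      funext i; ring
    rwa [h2, pow_one, ← pow_mul, mul_comm N] at h
  have hsucc : ∀ e, f ^ (ν e + 1) ∈ b e := fun e => by
    by_contra h
    have := (hν e).2 h
    omega
  have h1 : ∀ e, p * ν e ≤ ν (e + 1) := fun e =>
    (hν (e + 1)).2 (mt (hfrob e (ν e)).1 (hν e).1)
  have h2 : ∀ e, ν (e + 1) + 1 ≤ p * (ν e + 1) := fun e => by
    by_contra! hlt
    refine (hν (e + 1)).1 ?_
    exact Ideal.mem_of_dvd _ (pow_dvd_pow f (by omega)) ((hfrob e _).2 (hsucc e))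
  have hle : ∀ e, (ν e : ℝ) ≤ p ^ e * ((weightedSize w a : ℝ) / d) := fun e => by
    rw [← mul_div_assoc, le_div_iff₀ hdR]
    exact_mod_cast hbound e _ (hν e).1
  have hclose : ∀ e, 0 < e → ¬ p ∣ ν e + 1 →
      (p : ℝ) ^ e * ((weightedSize w a : ℝ) / d) < ν e + n := by
    intro e he hnd
    -- Differentiate f^(ν_e + 1) ∈ b_e and divide by ν_e + 1, a unit in `K`.
    have hmul : ∀ i, f ^ ν e * pderiv i f ∈ b e := by
      intro i
      have h3 := pderiv_mem_varPowIdeal (K := K) (p := p)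
        (fun i => (dvd_pow_self p he.ne').mul_right (a i)) i (hsucc e)
      rw [pderiv_pow, Nat.add_sub_cancel] at h3
      have h4 : ((ν e + 1 : ℕ) : K) ≠ 0 := fun h => hnd ((CharP.cast_eq_zero_iff K p _).1 h)
      have h5 := Ideal.mul_mem_left _ (C ((ν e + 1 : ℕ) : K)⁻¹) h3
      have h6 : C ((ν e + 1 : ℕ) : K)⁻¹ * (((ν e + 1 : ℕ) : MvPolynomial (Fin n) K) *
          f ^ ν e * pderiv i f) = f ^ ν e * pderiv i f := by
        rw [← map_natCast (C : K →+* MvPolynomial (Fin n) K), mul_assoc, ← mul_assoc, ← C_mul,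
          inv_mul_cancel₀ h4, C_1, one_mul]
      rwa [h6] at h5
    have h3 := le_degree_of_mul_pderiv_mem hw hfw hrad.ge (hpow (ν e)) (hν e).1 hmul
    rw [hsize] at h3
    have h4 : ∑ i, (d - w i) < n * d := by
      calc ∑ i, (d - w i) < ∑ _i : Fin n, d :=
            Finset.sum_lt_sum_of_nonempty ⟨⟨0, hn⟩, Finset.mem_univ _⟩ fun i _ => by
              have := hw i; omega
        _ = n * d := by simp
    rw [← mul_div_assoc, div_lt_iff₀ hdR, add_mul]
    exact_mod_cast h3.trans_lt (Nat.add_lt_add_left h4 _)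
  obtain ⟨c, hc, hcases⟩ := exists_limit_of_digit_sequence hp.one_lt h1 h2
    (x := (weightedSize w a : ℝ) / d) (by positivity)
    ((div_le_one hdR).2 (by exact_mod_cast had)) hle hclose
  refine ⟨c, ⟨ν, fun e => ?_, hc⟩, hcases⟩
  simpa only [IsNuInvariant, hset] using hν e
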